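/- There is a universal constant $C>0$ such that the following holds for every dimension $d$, every nonzero complex matrix $A=(a_{k\ell})\in\mathbb{C}^{d\times d}$, and any two independent random vectors $u,v\sim\mathcal{CN}(0,I)$ in $\mathbb{C}^d$ (that is, the real and imaginary parts of all entries of each vector are i.i.d. real normal variables of mean $0$ and variance $1/2$): for every $t>0$, $$\Pr\bigl(|v^{\dagger}Au|\le t\,\|A\|_F\bigr)\le C\sqrt{t},$$ where $v^{\dagger}$ is the conjugate transpose of $v$ and $\|A\|_F=\bigl(\sum_{k,\ell=1}^{d}|a_{k\ell}|^2\bigr)^{1/2}$ is the Frobenius norm. The constant $C$ does not depend on $d$, $A$, $u$, $v$ or $t$. -/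

import Mathlib

open MeasureTheory ProbabilityTheory
open scoped NNReal Matrix Matrix.Norms.Frobenius

noncomputable section

/-- The standard complex normal law `CN(0, 1)` on `ℂ`: the law of `x + i y` with `x`, `y`
independent real normal variables of mean `0` and variance `1/2`. -/
def stdComplexNormal : Measure ℂ :=
  ((gaussianReal 0 (1 / 2 : ℝ≥0)).prod (gaussianReal 0 (1 / 2 : ℝ≥0))).map
    (fun p : ℝ × ℝ => (p.1 : ℂ) + (p.2 : ℂ) * Complex.I)

instance : IsProbabilityMeasure stdComplexNormal :=
  Measure.isProbabilityMeasure_map (by fun_prop)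

/-- The standard complex normal law `CN(0, I)` on `ℂ^d`: the coordinates are independent,
each with law `CN(0, 1)`. -/
def stdComplexNormalVec (d : ℕ) : Measure (Fin d → ℂ) :=
  Measure.pi (fun _ => stdComplexNormal)

end

open scoped ENNReal

/-! Condition on `u`. For fixed `b`, the real part of `v†b` is a real Gaussian of variance `‖b‖² /
2` (Euclidean norm), so its density is at most `1 / (√π ‖b‖)` and `|v†b| ≤ s` has probability at
most `2s / ‖b‖` (`stdComplexNormalVec_norm_star_dotProduct_le`). With `b = Au` this is useful unless
`‖Au‖` is small, and `‖Au‖ ≤ δ‖A‖_F` has probability at most `8δ`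
(`stdComplexNormalVec_sum_norm_mulVec_sq_le`). The choice `δ = √t` makes both contributions of order
`√t`. -/

lemma gaussianReal_le_mul_volume (m : ℝ) {v : ℝ≥0} (hv : v ≠ 0) (s : Set ℝ) :
    gaussianReal m v s ≤ ENNReal.ofReal (√(2 * Real.pi * v))⁻¹ * volume s := by
  rw [gaussianReal_apply m hv, ← setLIntegral_const]
  refine lintegral_mono fun x => ENNReal.ofReal_le_ofReal ?_
  rw [gaussianPDFReal_def]
  refine mul_le_of_le_one_right (by positivity) (Real.exp_le_one_iff.2 ?_)
  rw [neg_div]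
  exact neg_nonpos.2 (by positivity)

lemma hasLaw_re_star_mul (b : ℂ) :
    HasLaw (fun z : ℂ => (star z * b).re) (gaussianReal 0 (‖b‖₊ ^ 2 / 2)) stdComplexNormal := by
  refine ⟨by fun_prop, ?_⟩
  set γ := gaussianReal 0 (1 / 2 : ℝ≥0)
  have hfst : HasLaw (fun p : ℝ × ℝ => p.1) γ (γ.prod γ) := ⟨by fun_prop, by simp⟩
  have hsnd : HasLaw (fun p : ℝ × ℝ => p.2) γ (γ.prod γ) := ⟨by fun_prop, by simp⟩
  have h1 := gaussianReal_mul_const hfst b.re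
  have h2 := gaussianReal_mul_const hsnd b.im
  have hind : IndepFun (fun p : ℝ × ℝ => p.1 * b.re) (fun p : ℝ × ℝ => p.2 * b.im) (γ.prod γ) :=
    indepFun_prod (X := fun x : ℝ => x * b.re) (Y := fun x : ℝ => x * b.im)
      (by fun_prop) (by fun_prop)
  have h3 := gaussianReal_add_gaussianReal_of_indepFun hind h1.map_eq h2.map_eq
  rw [stdComplexNormal, Measure.map_map (by fun_prop) (by fun_prop)]
  convert h3 using 2
  · ext p
    simp
  · simp
  · ext
    simp [← Complex.normSq_eq_norm_sq, Complex.normSq_apply]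
    ring

lemma iIndepFun.hasLaw_sum_gaussianReal {ι Ω : Type*} [MeasurableSpace Ω] {P : Measure Ω}
    [IsProbabilityMeasure P] {X : ι → Ω → ℝ} {σ : ι → ℝ≥0}
    (hind : iIndepFun X P) (hX : ∀ i, Measurable (X i))
    (hlaw : ∀ i, HasLaw (X i) (gaussianReal 0 (σ i)) P) (s : Finset ι) :
    HasLaw (∑ i ∈ s, X i) (gaussianReal 0 (∑ i ∈ s, σ i)) P := by
  classical
  induction s using Finset.induction_on with
  | empty => exact ⟨by fun_prop, by simp [Pi.zero_def, Measure.map_const]⟩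
  | insert i s hi ih =>
    refine ⟨by fun_prop, ?_⟩
    rw [Finset.sum_insert hi, Finset.sum_insert hi, add_comm (X i), add_comm (σ i)]
    simpa using gaussianReal_add_gaussianReal_of_indepFun
      (hind.indepFun_finsetSum_of_notMem hX hi) ih.map_eq (hlaw i).map_eq

instance (d : ℕ) : IsProbabilityMeasure (stdComplexNormalVec d) := by
  unfold stdComplexNormalVec
  infer_instance

lemma hasLaw_re_star_dotProduct {d : ℕ} (b : Fin d → ℂ) :
    HasLaw (fun v : Fin d → ℂ => (star v ⬝ᵥ b).re)
      (gaussianReal 0 (∑ i, ‖b i‖₊ ^ 2 / 2)) (stdComplexNormalVec d) := by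
  have hind : iIndepFun (fun i (v : Fin d → ℂ) => (star (v i) * b i).re)
      (stdComplexNormalVec d) :=
    iIndepFun_pi (X := fun i (z : ℂ) => (star z * b i).re) (fun i => by fun_prop)
  have hlaw (i : Fin d) : HasLaw (fun v : Fin d → ℂ => (star (v i) * b i).re)
      (gaussianReal 0 (‖b i‖₊ ^ 2 / 2)) (stdComplexNormalVec d) :=
    (hasLaw_re_star_mul (b i)).comp
      ((measurePreserving_eval (fun _ : Fin d => stdComplexNormal) i).hasLaw)
  convert iIndepFun.hasLaw_sum_gaussianReal hind (fun i => by fun_prop) hlaw Finset.univ using 1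
  ext v
  simp [dotProduct, Finset.sum_apply]

/-- Discarding the imaginary part leaves a one-dimensional density bound, linear in `s`, which is
enough here. Only a lower bound `r` on the norm of `b` is needed. -/
lemma stdComplexNormalVec_norm_star_dotProduct_le {d : ℕ} (b : Fin d → ℂ) {s r : ℝ}
    (hr : 0 < r) (hb : r ^ 2 ≤ ∑ i, ‖b i‖ ^ 2) :
    stdComplexNormalVec d {v | ‖star v ⬝ᵥ b‖ ≤ s} ≤ ENNReal.ofReal (2 * s / r) := by
  rcases lt_or_ge s 0 with hs | hs
  · have : {v : Fin d → ℂ | ‖star v ⬝ᵥ b‖ ≤ s} = ∅ := by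
      ext v
      simpa using hs.trans_le (norm_nonneg _)
    simp [this]
  have hσ : r ^ 2 / 2 ≤ ((∑ i, ‖b i‖₊ ^ 2 / 2 : ℝ≥0) : ℝ) := by
    push_cast
    rw [← Finset.sum_div]
    gcongr
  have hσ0 : (∑ i, ‖b i‖₊ ^ 2 / 2 : ℝ≥0) ≠ 0 := fun h => by
    rw [h] at hσ
    have := sq_pos_of_pos hr
    rw [NNReal.coe_zero] at hσ
    linarith
  calc stdComplexNormalVec d {v | ‖star v ⬝ᵥ b‖ ≤ s}
      ≤ stdComplexNormalVec d ((fun v => (star v ⬝ᵥ b).re) ⁻¹' Set.Icc (-s) s) :=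
        measure_mono fun v hv => abs_le.1 ((Complex.abs_re_le_norm _).trans hv)
    _ = gaussianReal 0 (∑ i, ‖b i‖₊ ^ 2 / 2) (Set.Icc (-s) s) := by
        rw [← (hasLaw_re_star_dotProduct b).map_eq,
          Measure.map_apply_of_aemeasurable (hasLaw_re_star_dotProduct b).aemeasurable
            measurableSet_Icc]
    _ ≤ _ := gaussianReal_le_mul_volume 0 hσ0 _
    _ ≤ ENNReal.ofReal (2 * s / r) := by
        rw [Real.volume_Icc, ← ENNReal.ofReal_mul (by positivity)]
        apply ENNReal.ofReal_le_ofReal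
        -- The radicand is at least `π r²`; the spare factor `π` is dropped.
        have h : r ≤ √(2 * Real.pi * (∑ i, ‖b i‖₊ ^ 2 / 2 : ℝ≥0)) :=
          Real.le_sqrt_of_sq_le (by nlinarith [Real.pi_gt_three])
        rw [div_eq_inv_mul, show s - -s = 2 * s by ring]
        gcongr

/-- The squared norm of `A *ᵥ u` is a weighted average of the squared moduli of normalised linear
forms in `u`, so Markov's inequality over the rows reduces its small-ball estimate to that of a
single linear form. -/
lemma stdComplexNormalVec_sum_norm_mulVec_sq_le {d : ℕ} (A : Matrix (Fin d) (Fin d) ℂ)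
    (hA : 0 < ∑ i, ∑ j, ‖A i j‖ ^ 2) {δ : ℝ} (hδ : 0 < δ) :
    stdComplexNormalVec d {u | ∑ i, ‖(A *ᵥ u) i‖ ^ 2 ≤ δ ^ 2 * ∑ i, ∑ j, ‖A i j‖ ^ 2}
      ≤ ENNReal.ofReal (8 * δ) := by
  set μ := stdComplexNormalVec d
  set w : Fin d → ℝ := fun i => ∑ j, ‖A i j‖ ^ 2
  have hw0 (i) : 0 ≤ w i := by positivity
  -- With the factor 2, a row outside `E i` contributes at least `4 δ² w i`. On the small-ball event
  -- the rows in `E i` thus carry at least 3/4 of the total weight; one half is all that is used.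
  set E : Fin d → Set (Fin d → ℂ) := fun i => {u | ‖(A *ᵥ u) i‖ ≤ 2 * δ * √(w i)}
  have hEm (i) : MeasurableSet (E i) :=
    measurableSet_le (by simp only [Matrix.mulVec, dotProduct]; fun_prop) measurable_const
  have hEμ (i) (hi : 0 < w i) : μ (E i) ≤ ENNReal.ofReal (4 * δ) := by
    have h := stdComplexNormalVec_norm_star_dotProduct_le (fun j => star (A i j))
      (s := 2 * δ * √(w i)) (r := √(w i)) (by positivity)
      (by rw [Real.sq_sqrt hi.le]; simp [w])
    have heq (u : Fin d → ℂ) : ‖star u ⬝ᵥ fun j => star (A i j)‖ = ‖(A *ᵥ u) i‖ := by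
      rw [← norm_star]
      congr 1
      simp [Matrix.mulVec, dotProduct, mul_comm]
    simp only [heq] at h
    refine h.trans_eq ?_
    congr 1
    field_simp
    ring
  have hmarkov (u) (hu : ∑ i, ‖(A *ᵥ u) i‖ ^ 2 ≤ δ ^ 2 * ∑ i, w i) :
      ENNReal.ofReal (∑ i, w i) ≤
        2 * ∑ i, ENNReal.ofReal (w i) * (E i).indicator 1 u := by
    have hterm (i) : δ ^ 2 * w i - δ ^ 2 * (E i).indicator (fun _ => w i) u
        ≤ ‖(A *ᵥ u) i‖ ^ 2 / 4 := by
      by_cases h : u ∈ E i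
      · simp only [h, Set.indicator_of_mem, sub_self]
        positivity
      · have hlt : 2 * δ * √(w i) < ‖(A *ᵥ u) i‖ := not_le.1 h
        have h' := pow_le_pow_left₀ (by positivity) hlt.le 2
        rw [mul_pow, Real.sq_sqrt (hw0 i)] at h'
        simp only [h, not_false_eq_true, Set.indicator_of_notMem]
        linarith
    have hsum := Finset.sum_le_sum fun i (_ : i ∈ Finset.univ) => hterm i
    rw [Finset.sum_sub_distrib, ← Finset.mul_sum, ← Finset.mul_sum, ← Finset.sum_div] at hsum
    have hreal : ∑ i, w i ≤ 2 * ∑ i, (E i).indicator (fun _ => w i) u := by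
      refine le_of_mul_le_mul_left ?_ (pow_pos hδ 2)
      have : 0 ≤ δ ^ 2 * ∑ i, w i := by positivity
      linarith
    refine (ENNReal.ofReal_le_ofReal hreal).trans_eq ?_
    rw [ENNReal.ofReal_mul (by norm_num), ENNReal.ofReal_sum_of_nonneg fun i _ =>
      Set.indicator_nonneg (fun _ _ => hw0 i) u, ENNReal.ofReal_ofNat]
    congr! 2 with i
    by_cases h : u ∈ E i <;> simp [h]
  have hint : ENNReal.ofReal (∑ i, w i) *
      μ {u | ∑ i, ‖(A *ᵥ u) i‖ ^ 2 ≤ δ ^ 2 * ∑ i, w i} ≤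
      ENNReal.ofReal (∑ i, w i) * ENNReal.ofReal (8 * δ) := by
    calc _ ≤ μ {u | ENNReal.ofReal (∑ i, w i) ≤
              2 * ∑ i, ENNReal.ofReal (w i) * (E i).indicator 1 u} *
                ENNReal.ofReal (∑ i, w i) := by
            rw [mul_comm]
            gcongr
            exact hmarkov _
      _ ≤ ∫⁻ u, 2 * ∑ i, ENNReal.ofReal (w i) * (E i).indicator 1 u ∂μ := by
            rw [mul_comm]
            exact mul_meas_ge_le_lintegral ((Finset.measurable_sum _ fun i _ =>
              (measurable_one.indicator (hEm i)).const_mul _).const_mul _) _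
      _ = 2 * ∑ i, ENNReal.ofReal (w i) * μ (E i) := by
            rw [lintegral_const_mul _ (Finset.measurable_sum _ fun i _ =>
              (measurable_one.indicator (hEm i)).const_mul _), lintegral_finsetSum _ fun i _ =>
              (measurable_one.indicator (hEm i)).const_mul _]
            congr! 2 with i
            rw [lintegral_const_mul _ (measurable_one.indicator (hEm i)),
              lintegral_indicator_one (hEm i)]
      _ ≤ 2 * ∑ i, ENNReal.ofReal (w i) * ENNReal.ofReal (4 * δ) := by
            gcongr 2 * ∑ i, ?_ with i
            -- For a zero row `E i` is the whole space, but its weight vanishes.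
            rcases (hw0 i).eq_or_lt with h | h
            · simp [← h]
            · gcongr
              exact hEμ i h
      _ = _ := by
            rw [← Finset.sum_mul, ← ENNReal.ofReal_sum_of_nonneg fun i _ => hw0 i,
              mul_left_comm, show 8 * δ = 2 * (4 * δ) by ring,
              ENNReal.ofReal_mul (p := 2) (by norm_num)]
            simp
  exact (ENNReal.mul_le_mul_iff_right (by simpa using hA) ENNReal.ofReal_ne_top).1 hint

theorem mainTheorem5 :
    ∃ C : ℝ, 0 < C ∧
      ∀ (d : ℕ) (A : Matrix (Fin d) (Fin d) ℂ), A ≠ 0 →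
      ∀ (Ω : Type*) [MeasurableSpace Ω] (P : Measure Ω) [IsProbabilityMeasure P]
        (u v : Ω → Fin d → ℂ),
        HasLaw u (stdComplexNormalVec d) P → HasLaw v (stdComplexNormalVec d) P →
        IndepFun u v P →
        ∀ t : ℝ, 0 < t →
          -- `‖A‖` is the Frobenius norm of `A`
          P.real {ω | ‖star (v ω) ⬝ᵥ A *ᵥ u ω‖ ≤ t * ‖A‖} ≤ C * √t := by
  -- `10 = 8 + 2`: 8 from small `‖Au‖`, 2 from the linear form in `v`.
  refine ⟨10, by norm_num, fun d A hA Ω _ P _ u v hu hv huv t ht => ?_⟩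
  set μ := stdComplexNormalVec d
  have hsq : ‖A‖ ^ 2 = ∑ i, ∑ j, ‖A i j‖ ^ 2 := by
    rw [Matrix.frobenius_norm_def, ← Real.sqrt_eq_rpow]
    simp only [Real.rpow_two]
    exact Real.sq_sqrt (by positivity)
  have hA0 : 0 < ‖A‖ := norm_pos_iff.2 hA
  have hs0 : 0 < √t := Real.sqrt_pos.2 ht
  set S : Set ((Fin d → ℂ) × (Fin d → ℂ)) := {p | ‖star p.2 ⬝ᵥ A *ᵥ p.1‖ ≤ t * ‖A‖}
  have hSm : MeasurableSet S :=
    measurableSet_le (by simp only [Matrix.mulVec, dotProduct]; fun_prop) measurable_const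
  have hlaw : P {ω | ‖star (v ω) ⬝ᵥ A *ᵥ u ω‖ ≤ t * ‖A‖} = (μ.prod μ) S := by
    have h := huv.map_prod_eq_prod_map_map hu.aemeasurable hv.aemeasurable
    rw [hu.map_eq, hv.map_eq] at h
    rw [← h, Measure.map_apply_of_aemeasurable
      (hu.aemeasurable.prodMk hv.aemeasurable) hSm]
    rfl
  set B : Set (Fin d → ℂ) := {x | ∑ i, ‖(A *ᵥ x) i‖ ^ 2 ≤ √t ^ 2 * ∑ i, ∑ j, ‖A i j‖ ^ 2}
  have hBm : MeasurableSet B :=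
    measurableSet_le (by simp only [Matrix.mulVec, dotProduct]; fun_prop) measurable_const
  have hB : μ B ≤ ENNReal.ofReal (8 * √t) :=
    stdComplexNormalVec_sum_norm_mulVec_sq_le A (hsq ▸ by positivity) hs0
  -- On `B` the trivial bound 1 is used; off `B` the form bound gives `2t‖A‖ / (√t‖A‖) = 2√t`.
  have hfib (x : Fin d → ℂ) : μ (Prod.mk x ⁻¹' S) ≤
      B.indicator 1 x + ENNReal.ofReal (2 * √t) := by
    by_cases hx : x ∈ B
    · simpa [hx] using prob_le_one.trans le_self_add
    · have h := stdComplexNormalVec_norm_star_dotProduct_le (A *ᵥ x)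
        (s := t * ‖A‖) (r := √t * ‖A‖) (by positivity)
        (by rw [mul_pow, hsq]; exact (not_le.1 hx).le)
      simp only [hx, not_false_eq_true, Set.indicator_of_notMem, zero_add]
      refine h.trans_eq ?_
      congr 1
      rw [div_eq_iff (by positivity)]
      linear_combination -2 * ‖A‖ * Real.mul_self_sqrt ht.le
  have hprod : (μ.prod μ) S ≤ ENNReal.ofReal (10 * √t) := by
    rw [Measure.prod_apply hSm]
    calc _ ≤ ∫⁻ x, B.indicator 1 x + ENNReal.ofReal (2 * √t) ∂μ := lintegral_mono hfib
      _ = μ B + ENNReal.ofReal (2 * √t) := by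
          rw [lintegral_add_right _ measurable_const, lintegral_indicator_one hBm]
          simp
      _ ≤ ENNReal.ofReal (8 * √t) + ENNReal.ofReal (2 * √t) := by gcongr
      _ = ENNReal.ofReal (10 * √t) := by
          rw [← ENNReal.ofReal_add (by positivity) (by positivity)]
          congr 1
          ring
  rw [measureReal_def, hlaw]
  exact ENNReal.toReal_le_of_le_ofReal (by positivity) hprod
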